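/- Let $n\ge 0$, let $G\subset\mathbb R^n$ be open, let $Y$ be a real Banach space, and let $f:G\to Y$ be Gâteaux differentiable at every point of $G$; that is, for each $x\in G$ there is a continuous linear map $L_x:\mathbb R^n\to Y$ with $\lim_{t\to 0}\frac{f(x+tv)-f(x)}{t}=L_x(v)$ for every $v\in\mathbb R^n$. (No measurability of $f$ is assumed.) Then the set of all points of $G$ at which $f$ is not Fréchet differentiable is nowhere dense and $\sigma$-porous. Here a set $A\subset\mathbb R^n$ is called porous if for every $x\in A$ there are $c>0$ and arbitrarily small $r>0$ such that the open ball $B(x,r)$ contains an open ball of radius $cr$ disjoint from $A$; and a set is called $\sigma$-porous if it is a countable union of porous sets. -/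

import Mathlib

open Filter Topology

/-- `f` is Gateaux differentiable at `x`: there is a continuous linear map `L` such that for each
direction `v` the two-sided directional derivative `lim_{t → 0} (f (x + t v) - f x) / t` exists
and equals `L v`. -/
def GateauxDifferentiableAt {X Y : Type*} [NormedAddCommGroup X] [NormedSpace ℝ X]
    [NormedAddCommGroup Y] [NormedSpace ℝ Y] (f : X → Y) (x : X) : Prop :=
  ∃ L : X →L[ℝ] Y, ∀ v : X, HasLineDerivAt ℝ f (L v) x v

/-- `A` is (upper) porous at `x`: `limsup_{r → 0+} γ(x, r, A) / r > 0`, where `γ(x, r, A)` is the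
supremum of the `s > 0` for which some open ball of radius `s` is contained in `B(x, r)` and is
disjoint from `A`. That is, for some `c > 0` there are arbitrarily small `r > 0` such that `B(x, r)`
contains an open ball of radius `c * r` that misses `A`. -/
def IsPorousAt {X : Type*} [MetricSpace X] (A : Set X) (x : X) : Prop :=
  ∃ c : ℝ, 0 < c ∧ ∃ᶠ r in 𝓝[>] (0 : ℝ), ∃ y : X,
    Metric.ball y (c * r) ⊆ Metric.ball x r ∧ Disjoint (Metric.ball y (c * r)) A

/-- `A` is porous: it is porous at each of its points. -/
def IsPorous {X : Type*} [MetricSpace X] (A : Set X) : Prop :=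
  ∀ x ∈ A, IsPorousAt A x

/-- `A` is σ-porous: it is a countable union of porous sets. -/
def IsSigmaPorous {X : Type*} [MetricSpace X] (A : Set X) : Prop :=
  ∃ P : ℕ → Set X, (∀ k, IsPorous (P k)) ∧ A = ⋃ k, P k

/-! The proof rests on a Baire category theorem for sets that are merely closed along lines
(`IsLineClosed.exists_interior_inter_nonempty`): if countably many such sets cover a nonempty open
subset of a finite-dimensional space, then one of them has interior there. It follows from Fubini
type slicing and induction on the dimension. It makes up for the lack of measurability and joint
continuity of `f`: a Gateaux differentiable `f` is continuous along lines, so that sets defined by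
closed conditions on its increments are closed along lines.

For an open ball `ball u s` of directions let `coneLipschitzSet f G δ K u s` be the set of `x` with
`‖f (x + t v) - f x‖ ≤ K |t|` for all `v ∈ ball u s` and `|t| < δ`. Applied to the set of good
directions at a fixed point, the category theorem shows that countably many of these sets cover
`G` (`exists_mem_coneLipschitzSet`). If such a set `A` is not porous at `x`, then `f` is Fréchet
differentiable at `x` as soon as it is Gateaux differentiable there
(`differentiableAt_of_not_isPorousAt`): two points `z`, `z'` near `x` with
`‖z - z'‖ ≤ η ‖z - x‖` both lie in the cone of a common point `q ∈ A` at distance comparable to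
`η ‖z - x‖`, so `‖f z - f z'‖` is of that order, and a finite net of directions upgrades Gateaux to
Fréchet differentiability. Hence the exceptional set meets each `A` in a porous set and misses the
interior of `A`. The sets `A` are themselves closed along lines, so, by the category theorem again,
their interiors are dense in `G`. -/

/-! ### Sets closed along lines -/

/-- A set is closed along lines if its trace on every affine line, in the usual parametrization, is
closed. -/
def IsLineClosed {E : Type*} [AddCommGroup E] [Module ℝ E] (D : Set E) : Prop :=
  ∀ x v : E, IsClosed {s : ℝ | x + s • v ∈ D}

/-- The category property: a countable cover of a nonempty open set by sets closed along lines has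
a member with interior points in the open set. -/
def HasLineBaireProperty (E : Type*) [AddCommGroup E] [Module ℝ E] [TopologicalSpace E] : Prop :=
  ∀ (D : ℕ → Set E) (V : Set E), (∀ m, IsLineClosed (D m)) → IsOpen V → V.Nonempty →
    V ⊆ ⋃ m, D m → ∃ m, (interior (D m) ∩ V).Nonempty

theorem IsLineClosed.preimage {E F : Type*} [AddCommGroup E] [Module ℝ E] [AddCommGroup F]
    [Module ℝ F] {D : Set F} (hD : IsLineClosed D) (e : E →ₗ[ℝ] F) : IsLineClosed (e ⁻¹' D) := by
  intro x v
  simpa using hD (e x) (e v)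

theorem HasLineBaireProperty.of_equiv {E F : Type*} [AddCommGroup E] [Module ℝ E]
    [TopologicalSpace E] [AddCommGroup F] [Module ℝ F] [TopologicalSpace F]
    (hF : HasLineBaireProperty F) (e : F ≃L[ℝ] E) : HasLineBaireProperty E := by
  intro D V hD hV hne hcov
  obtain ⟨m, y, hy, hyV⟩ := hF (fun m => e ⁻¹' D m) (e ⁻¹' V)
    (fun m => (hD m).preimage (e : F →ₗ[ℝ] E)) (hV.preimage e.continuous)
    (hne.preimage e.surjective) (by rw [← Set.preimage_iUnion]; exact Set.preimage_mono hcov)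
  refine ⟨m, e y, ?_, hyV⟩
  have := e.toHomeomorph.preimage_interior (D m)
  exact this.symm.subset hy

theorem HasLineBaireProperty.of_subsingleton {E : Type*} [AddCommGroup E] [Module ℝ E]
    [TopologicalSpace E] [Subsingleton E] : HasLineBaireProperty E := by
  intro D V _ _ ⟨x, hx⟩ hcov
  obtain ⟨m, hm⟩ := Set.mem_iUnion.1 (hcov hx)
  refine ⟨m, x, ?_, hx⟩
  rw [(isOpen_discrete (D m)).interior_eq]
  exact hm

/-- The inductive step: the slices over points of the line have the category property, and the set
of parameters whose slice contains a given basic open set is closed. -/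
theorem HasLineBaireProperty.prod_real {F : Type*} [AddCommGroup F] [Module ℝ F]
    [TopologicalSpace F] [SecondCountableTopology F] (hF : HasLineBaireProperty F) :
    HasLineBaireProperty (F × ℝ) := by
  rintro D V hD hV ⟨⟨x₀, t₀⟩, h₀⟩ hcov
  obtain ⟨U, J, hU, hJ, hxU, htJ, hUJ⟩ := isOpen_prod_iff.1 hV x₀ t₀ h₀
  let B := {b : Set F // b ∈ TopologicalSpace.countableBasis F ∧ b ⊆ U ∧ b.Nonempty}
  have : Countable B :=
    ((TopologicalSpace.countable_countableBasis F).mono (fun b hb => hb.1)).to_subtype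
  let T : ℕ × B → Set ℝ := fun p => {t | ∀ x ∈ p.2.1, (x, t) ∈ D p.1}
  have hT : ∀ p, IsClosed (T p) := by
    intro p
    have h : T p = ⋂ x ∈ p.2.1, {t : ℝ | (x, (0 : ℝ)) + t • ((0 : F), (1 : ℝ)) ∈ D p.1} := by
      ext t
      simp [T]
    rw [h]
    exact isClosed_biInter fun x _ => hD p.1 _ _
  have hJT : ∀ t ∈ J, ∃ p, t ∈ T p := by
    intro t ht
    obtain ⟨m, x, hx, hxU⟩ := hF (fun m => {x | (x, t) ∈ D m}) U
      (fun m x v => by simpa using hD m (x, t) (v, 0)) hU ⟨x₀, hxU⟩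
      (fun x hx => by simpa using hcov (hUJ ⟨hx, ht⟩))
    obtain ⟨b, hb, hxb, hbU⟩ :=
      (TopologicalSpace.isBasis_countableBasis F).exists_subset_of_mem_open
        (show x ∈ interior {x | (x, t) ∈ D m} ∩ U from ⟨hx, hxU⟩) (isOpen_interior.inter hU)
    exact ⟨(m, ⟨b, hb, fun y hy => (hbU hy).2, x, hxb⟩), fun y hy =>
      interior_subset (s := {x | (x, t) ∈ D m}) (hbU hy).1⟩
  obtain ⟨p₀, hp₀⟩ := hJT t₀ htJ
  have hdense : Dense (⋃ p, interior (T p ∪ Jᶜ)) := by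
    refine dense_iUnion_interior_of_closed (fun p => (hT p).union hJ.isClosed_compl) ?_
    refine Set.eq_univ_of_forall fun t => Set.mem_iUnion.2 ?_
    by_cases ht : t ∈ J
    · obtain ⟨p, hp⟩ := hJT t ht
      exact ⟨p, Or.inl hp⟩
    · exact ⟨p₀, Or.inr ht⟩
  obtain ⟨t, htJ', ht⟩ := hdense.inter_open_nonempty J hJ ⟨t₀, htJ⟩
  obtain ⟨⟨m, b, hb, hbU, x, hx⟩, hp⟩ := Set.mem_iUnion.1 ht
  refine ⟨m, (x, t), ?_, hUJ ⟨hbU hx, htJ'⟩⟩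
  refine mem_interior.2 ⟨b ×ˢ (interior (T (m, ⟨b, hb, hbU, x, hx⟩) ∪ Jᶜ) ∩ J), ?_,
    (TopologicalSpace.isOpen_of_mem_countableBasis hb).prod (isOpen_interior.inter hJ), hx, hp,
    htJ'⟩
  rintro ⟨y, r⟩ ⟨hy, hr, hrJ⟩
  rcases interior_subset hr with h | h
  · exact h y hy
  · exact absurd hrJ h

theorem hasLineBaireProperty_pi (n : ℕ) : HasLineBaireProperty (Fin n → ℝ) := by
  induction n with
  | zero => exact .of_subsingleton
  | succ n ih => exact ih.prod_real.of_equiv (ContinuousLinearEquiv.ofFinrankEq (by simp))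

theorem IsLineClosed.exists_interior_inter_nonempty {E : Type*} [NormedAddCommGroup E]
    [NormedSpace ℝ E] [FiniteDimensional ℝ E] {ι : Type*} [Countable ι] {D : ι → Set E}
    {V : Set E} (hD : ∀ i, IsLineClosed (D i)) (hV : IsOpen V) (hne : V.Nonempty)
    (hcov : V ⊆ ⋃ i, D i) : ∃ i, (interior (D i) ∩ V).Nonempty := by
  have hE : HasLineBaireProperty E := (hasLineBaireProperty_pi (Module.finrank ℝ E)).of_equiv
    (ContinuousLinearEquiv.ofFinrankEq (by simp))
  obtain ⟨x, hx⟩ := hne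
  obtain ⟨i, -⟩ := Set.mem_iUnion.1 (hcov hx)
  have : Nonempty ι := ⟨i⟩
  obtain ⟨g, hg⟩ := exists_surjective_nat ι
  obtain ⟨m, hm⟩ := hE (fun m => D (g m)) V (fun m => hD _) hV ⟨x, hx⟩
    (by rwa [hg.iUnion_comp D])
  exact ⟨g m, hm⟩

/-! ### Points where a function is Lipschitz along a cone -/

section

variable {E Y : Type*} [NormedAddCommGroup E] [NormedSpace ℝ E] [NormedAddCommGroup Y]

/-- The set of points `x`, at distance at least `δ` from the complement of `G`, at which `f` is
Lipschitz with constant `K` up to time `δ` along the double cone of directions `ball u s`. The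
directions are required to be in the closed unit ball, so that the segments stay in `G`; if
`ball u s` is not contained in it, the set is empty. -/
def coneLipschitzSet (f : E → Y) (G : Set E) (δ K : ℝ) (u : E) (s : ℝ) : Set E :=
  {x | Metric.ball x δ ⊆ G ∧ ∀ v ∈ Metric.ball u s, ‖v‖ ≤ 1 ∧
    ∀ t : ℝ, |t| < δ → ‖f (x + t • v) - f x‖ ≤ K * |t|}

theorem GateauxDifferentiableAt.continuousAt_line [NormedSpace ℝ Y] {f : E → Y} {x : E}
    (h : GateauxDifferentiableAt f x) (v : E) :
    ContinuousAt (fun s : ℝ => f (x + s • v)) 0 := by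
  obtain ⟨L, hL⟩ := h
  exact (hL v).continuousAt

theorem continuousAt_comp_line {E Y : Type*} [AddCommGroup E] [Module ℝ E] [TopologicalSpace Y]
    {f : E → Y} {x v : E} {s : ℝ}
    (h : ContinuousAt (fun r : ℝ => f (x + s • v + r • v)) 0) :
    ContinuousAt (fun r : ℝ => f (x + r • v)) s := by
  have h1 : ContinuousAt (fun r : ℝ => r - s) s := by fun_prop
  have h2 := ContinuousAt.comp_of_eq h h1 (sub_self s)
  convert h2 using 2 with r
  simp only [Function.comp]
  congr 1
  module

theorem isClosed_ball_subset {X : Type*} [PseudoMetricSpace X] (G : Set X) (δ : ℝ) :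
    IsClosed {x | Metric.ball x δ ⊆ G} := by
  have h : {x | Metric.ball x δ ⊆ G} = ⋂ y ∈ Gᶜ, {x | δ ≤ dist y x} := by
    ext x
    simp only [Set.mem_ofPred_eq, Set.mem_iInter, Set.subset_def, Metric.mem_ball]
    exact forall_congr' fun y => by rw [← not_lt, Set.mem_compl_iff, not_imp_not]
  rw [h]
  exact isClosed_biInter fun y _ => isClosed_le continuous_const (by fun_prop)

theorem add_smul_mem_ball {x v : E} {δ t : ℝ} (hv : ‖v‖ ≤ 1) (ht : |t| < δ) :
    x + t • v ∈ Metric.ball x δ := by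
  rw [mem_ball_iff_norm, add_sub_cancel_left, norm_smul, Real.norm_eq_abs]
  nlinarith [abs_nonneg t]

theorem isLineClosed_coneLipschitzSet {f : E → Y} {G : Set E}
    (hf : ∀ x ∈ G, ∀ v, ContinuousAt (fun s : ℝ => f (x + s • v)) 0) {δ : ℝ} (hδ : 0 < δ)
    (K : ℝ) (u : E) (s : ℝ) : IsLineClosed (coneLipschitzSet f G δ K u s) := by
  intro x w
  let C : Set ℝ := {r | Metric.ball (x + r • w) δ ⊆ G}
  have hC : IsClosed C := (isClosed_ball_subset G δ).preimage (by fun_prop)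
  have h : {r : ℝ | x + r • w ∈ coneLipschitzSet f G δ K u s} =
      C ∩ ⋂ v ∈ Metric.ball u s, ({_r | ‖v‖ ≤ 1} ∩
        ⋂ (t : ℝ) (_ : |t| < δ), {r ∈ C | ‖v‖ ≤ 1 ∧
          ‖f (x + r • w + t • v) - f (x + r • w)‖ ≤ K * |t|}) := by
    ext r
    simp only [coneLipschitzSet, Set.mem_ofPred_eq, Set.mem_inter_iff, Set.mem_iInter, C]
    grind
  rw [h]
  refine hC.inter (isClosed_biInter fun v _ => isClosed_const.inter
    (isClosed_biInter fun t ht => ?_))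
  by_cases hv : ‖v‖ ≤ 1
  · simp only [hv, true_and]
    refine hC.isClosed_le (fun r hr => ContinuousAt.continuousWithinAt ?_) continuousOn_const
    refine (ContinuousAt.sub ?_ ?_).norm
    · have : ContinuousAt (fun r : ℝ => f (x + t • v + r • w)) r := by
        apply continuousAt_comp_line
        apply hf
        rw [add_right_comm]
        exact hr (add_smul_mem_ball hv ht)
      simpa only [add_right_comm] using this
    · exact continuousAt_comp_line (hf _ (hr (Metric.mem_ball_self hδ)) _)
  · simp [hv]

/-- Every point of `G` is in one of countably many cone Lipschitz sets: the good directions with a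
given constant form a set closed along lines, and these sets cover the unit ball. -/
theorem exists_mem_coneLipschitzSet [NormedSpace ℝ Y] [FiniteDimensional ℝ E] {f : E → Y}
    {G : Set E} (hG : IsOpen G) (hf : ∀ x ∈ G, GateauxDifferentiableAt f x) {x : E} (hx : x ∈ G) :
    ∃ m i l : ℕ, x ∈ coneLipschitzSet f G (1 / (m + 1)) (m + 1)
      (TopologicalSpace.denseSeq E i) (1 / (l + 1)) := by
  obtain ⟨ρ, hρ, hball⟩ := Metric.isOpen_iff.1 hG x hx
  have hsmall : ∀ ε : ℝ, 0 < ε → ∀ᶠ m : ℕ in atTop, (1 : ℝ) / (m + 1) < ε := fun ε hε =>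
    tendsto_one_div_add_atTop_nhds_zero_nat.eventually_lt_const hε
  let D : ℕ → Set E := fun m => {v | ‖v‖ ≤ 1 ∧ ∀ t : ℝ, |t| < min ρ (1 / (m + 1)) →
    ‖f (x + t • v) - f x‖ ≤ (m + 1) * |t|}
  have hD : ∀ m, IsLineClosed (D m) := by
    intro m v w
    let C : Set ℝ := {r | ‖v + r • w‖ ≤ 1}
    have hC : IsClosed C := isClosed_le (by fun_prop) continuous_const
    have h : {r : ℝ | v + r • w ∈ D m} = C ∩ ⋂ (t : ℝ) (_ : |t| < min ρ (1 / (m + 1))),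
        {r ∈ C | ‖f (x + t • (v + r • w)) - f x‖ ≤ (m + 1) * |t|} := by
      ext r
      simp only [D, C, Set.mem_ofPred_eq, Set.mem_inter_iff, Set.mem_iInter]
      grind
    rw [h]
    refine hC.inter (isClosed_biInter fun t ht => ?_)
    refine hC.isClosed_le (fun r hr => ContinuousAt.continuousWithinAt ?_) continuousOn_const
    refine (ContinuousAt.sub ?_ continuousAt_const).norm
    have hmem : x + t • v + r • (t • w) ∈ G := by
      have h1 := hball (add_smul_mem_ball (x := x) hr (lt_of_lt_of_le ht (min_le_left _ _)))
      convert h1 using 1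
      module
    have := continuousAt_comp_line ((hf _ hmem).continuousAt_line (t • w))
    convert this using 3 with r
    module
  -- On a line the difference quotients are bounded near `0`, so every direction is in some
  -- `D m`.
  have hcov : Metric.ball (0 : E) 1 ⊆ ⋃ m, D m := by
    intro v hv
    obtain ⟨L, hL⟩ := hf x hx
    obtain ⟨c, hc⟩ := (HasDerivAt.isBigO_sub (hL v)).bound
    obtain ⟨ε, hε, hcε⟩ := Metric.eventually_nhds_iff.1 hc
    obtain ⟨m, hmε, hmc⟩ := ((hsmall ε hε).and (eventually_ge_atTop ⌈c⌉₊)).exists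
    refine Set.mem_iUnion.2 ⟨m, (mem_ball_zero_iff.1 hv).le, fun t ht => ?_⟩
    have hct : ‖f (x + t • v) - f x‖ ≤ c * |t| := by
      simpa using hcε (y := t)
        (by simpa using (lt_of_lt_of_le ht (min_le_right _ _)).trans hmε)
    have hcm : c ≤ m + 1 := (Nat.ceil_le.1 hmc).trans (by simp)
    exact hct.trans (by gcongr)
  obtain ⟨m, v, hv, -⟩ := IsLineClosed.exists_interior_inter_nonempty hD Metric.isOpen_ball
    ⟨0, by simp⟩ hcov
  obtain ⟨ε, hε, hvε⟩ := Metric.isOpen_iff.1 isOpen_interior v hv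
  obtain ⟨l, hl⟩ := (hsmall (ε / 2) (half_pos hε)).exists
  have hl0 : (0 : ℝ) < 1 / (l + 1) := by positivity
  obtain ⟨i, hi⟩ := (TopologicalSpace.denseRange_denseSeq E).exists_dist_lt v (half_pos hε)
  obtain ⟨k, hkρ, hkm⟩ := ((hsmall ρ hρ).and (eventually_ge_atTop m)).exists
  have hmk : (m : ℝ) ≤ k := by exact_mod_cast hkm
  refine ⟨k, i, l, (Metric.ball_subset_ball hkρ.le).trans hball, fun w hw => ?_⟩
  have hwD : w ∈ D m := by
    refine interior_subset (hvε ?_)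
    rw [Metric.mem_ball] at hw ⊢
    calc dist w v ≤ dist w (TopologicalSpace.denseSeq E i) +
          dist (TopologicalSpace.denseSeq E i) v := dist_triangle _ _ _
      _ < ε := by rw [dist_comm _ v]; linarith
  refine ⟨hwD.1, fun t ht => (hwD.2 t (lt_min (ht.trans hkρ) (ht.trans_le ?_))).trans ?_⟩
  · exact one_div_le_one_div_of_le (by positivity) (by linarith)
  · gcongr

/-! ### Porosity and Fréchet differentiability -/

theorem IsPorousAt.mono {X : Type*} [MetricSpace X] {A B : Set X} {x : X} (h : IsPorousAt B x)
    (hAB : A ⊆ B) : IsPorousAt A x := by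
  obtain ⟨c, hc, hr⟩ := h
  exact ⟨c, hc, hr.mono fun r ⟨y, h1, h2⟩ => ⟨y, h1, h2.mono_right hAB⟩⟩

theorem not_isPorousAt_of_mem_interior {X : Type*} [MetricSpace X] {A : Set X} {x : X}
    (hx : x ∈ interior A) :
    ¬ IsPorousAt A x := by
  rintro ⟨c, hc, hr⟩
  obtain ⟨ε, hε, hA⟩ := Metric.isOpen_iff.1 isOpen_interior x hx
  obtain ⟨r, ⟨y, hy, hd⟩, hr0, hrε⟩ := (hr.and_eventually (Ioo_mem_nhdsGT hε)).exists
  have hyc : y ∈ Metric.ball y (c * r) := Metric.mem_ball_self (mul_pos hc hr0)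
  exact Set.disjoint_left.1 hd hyc
    (interior_subset (hA (Metric.ball_subset_ball hrε.le (hy hyc))))

/-- With `r = ‖h‖`, choose `v` in a finite `η`-net of the unit ball with `‖h - r v‖ < η r`.
Non-porosity provides a point `q` of the cone Lipschitz set, at distance `O(η r)` from `x + h`, whose
cone contains both `x + h` and `x + r v`. So `f (x + h)` and `f (x + r v)` differ by `O(η r)`, and
the latter is controlled by the Gateaux derivative, uniformly over the net. -/
theorem differentiableAt_of_not_isPorousAt [NormedSpace ℝ Y] [FiniteDimensional ℝ E] {f : E → Y}
    {G : Set E} {δ K : ℝ} {u : E} {s : ℝ} {x : E} (hδ : 0 < δ) (hK : 0 ≤ K) (hs : 0 < s)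
    (hA : ¬ IsPorousAt (coneLipschitzSet f G δ K u s) x) (hf : GateauxDifferentiableAt f x) :
    DifferentiableAt ℝ f x := by
  obtain ⟨L, hL⟩ := hf
  refine HasFDerivAt.differentiableAt (f' := L) ?_
  rw [hasFDerivAt_iff_isLittleO_nhds_zero, Asymptotics.isLittleO_iff]
  intro ε hε
  let M : ℝ := 4 * K / s + 1 + ‖L‖
  have hM : 0 < M := by positivity
  obtain ⟨η, hη, hηε⟩ : ∃ η : ℝ, 0 < η ∧ η * M ≤ ε := ⟨ε / M, by positivity, by field_simp; rfl⟩
  obtain ⟨N, hNfin, hN⟩ := Metric.totallyBounded_iff.1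
    (isCompact_closedBall (0 : E) 1).totallyBounded η hη
  -- `ball (x + h + τ u) (η r)`, with `r = ‖h‖` and `τ = 2 η r / s`, lies in `ball x (R r)`.
  let R : ℝ := 1 + 2 * η / s * ‖u‖ + η
  have hR : 0 < R := by positivity
  have hnet : ∀ᶠ r : ℝ in 𝓝[>] 0, ∀ v ∈ N, ‖f (x + r • v) - f x - r • L v‖ ≤ η * r := by
    rw [Filter.eventually_all_finite hNfin]
    intro v _
    have h := (hasDerivAt_iff_isLittleO_nhds_zero.1 (hL v)).def hη
    filter_upwards [nhdsWithin_le_nhds h, self_mem_nhdsWithin] with r hr hr0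
    simpa [abs_of_pos (Set.mem_Ioi.1 hr0)] using hr
  have hpor : ∀ᶠ r : ℝ in 𝓝[>] 0, ∀ y : E, Metric.ball y (η * r) ⊆ Metric.ball x (R * r) →
      ∃ q ∈ coneLipschitzSet f G δ K u s, q ∈ Metric.ball y (η * r) := by
    have h : ∀ᶠ r : ℝ in 𝓝[>] 0, ¬ ∃ y : E, Metric.ball y (η / R * r) ⊆ Metric.ball x r ∧
        Disjoint (Metric.ball y (η / R * r)) (coneLipschitzSet f G δ K u s) := by
      rw [← Filter.not_frequently]
      exact fun h => hA ⟨η / R, by positivity, h⟩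
    have hmul : Tendsto (fun r : ℝ => R * r) (𝓝[>] 0) (𝓝[>] 0) := by
      refine tendsto_nhdsWithin_iff.2 ⟨?_, ?_⟩
      · exact ((continuous_const_mul R).tendsto' 0 0 (by simp)).mono_left nhdsWithin_le_nhds
      · filter_upwards [self_mem_nhdsWithin] with r hr using mul_pos hR hr
    filter_upwards [hmul.eventually h] with r hr y hy
    have hRr : η / R * (R * r) = η * r := by field_simp
    rw [hRr] at hr
    by_contra! hq
    exact hr ⟨y, hy, Set.disjoint_left.2 fun q h1 h2 => hq q h2 h1⟩
  have hlt : ∀ᶠ r : ℝ in 𝓝[>] 0, 2 * η * r / s < δ := by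
    have : Tendsto (fun r : ℝ => 2 * η * r / s) (𝓝 0) (𝓝 0) :=
      Continuous.tendsto' (by fun_prop) 0 0 (by simp)
    exact nhdsWithin_le_nhds (this.eventually_lt_const hδ)
  obtain ⟨ρ, hρ, hall⟩ := mem_nhdsGT_iff_exists_Ioo_subset.1 (hnet.and (hpor.and hlt))
  filter_upwards [Metric.ball_mem_nhds (0 : E) hρ] with h hh
  rcases eq_or_ne h 0 with rfl | h0
  · simp
  set r : ℝ := ‖h‖ with hr
  have hr0 : 0 < r := norm_pos_iff.2 h0
  obtain ⟨hnet', hpor', hlt'⟩ := hall ⟨hr0, by simpa using hh⟩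
  have hv : r⁻¹ • h ∈ Metric.closedBall (0 : E) 1 := by
    rw [mem_closedBall_zero_iff, norm_smul, norm_inv, Real.norm_eq_abs, abs_of_pos hr0, ← hr,
      inv_mul_cancel₀ hr0.ne']
  obtain ⟨v, hvN, hv⟩ := Set.mem_iUnion₂.1 (hN hv)
  have hhv : ‖h - r • v‖ < η * r := by
    have h1 : h - r • v = r • (r⁻¹ • h - v) := by
      rw [smul_sub, smul_inv_smul₀ hr0.ne']
    rw [h1, norm_smul, Real.norm_eq_abs, abs_of_pos hr0, mul_comm]
    exact mul_lt_mul_of_pos_right (mem_ball_iff_norm.1 hv) hr0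
  -- `τ` is chosen so that an error of `2 η r`, divided by `τ`, is the aperture `s` of the cone.
  let τ : ℝ := 2 * η * r / s
  have hτ : 0 < τ := by positivity
  have hτs : s * τ = η * r + η * r := by simp only [τ]; field_simp; ring
  obtain ⟨q, hqA, hq⟩ := hpor' (x + h + τ • u) (by
    refine Metric.ball_subset_ball' ?_
    have hd : dist (x + h + τ • u) x ≤ r + τ * ‖u‖ := by
      rw [dist_eq_norm, add_assoc, add_sub_cancel_left]
      refine (norm_add_le _ _).trans_eq ?_
      rw [norm_smul, Real.norm_eq_abs, abs_of_pos hτ]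
    have hRr : R * r = r + τ * ‖u‖ + η * r := by simp only [R, τ]; ring
    linarith)
  have key : ∀ p : E, ‖p‖ < η * r → ‖f (x + h - p) - f q‖ ≤ K * τ := by
    intro p hp
    have hq' := mem_ball_iff_norm.1 hq
    have hmem : u + τ⁻¹ • (q - (x + h + τ • u) + p) ∈ Metric.ball u s := by
      rw [mem_ball_iff_norm, add_sub_cancel_left, norm_smul, norm_inv, Real.norm_eq_abs,
        abs_of_pos hτ, inv_mul_lt_iff₀ hτ, mul_comm τ, hτs]
      exact (norm_add_le _ _).trans_lt (add_lt_add hq' hp)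
    have h1 := (hqA.2 _ hmem).2 (-τ) (by rwa [abs_neg, abs_of_pos hτ])
    rw [abs_neg, abs_of_pos hτ, neg_smul, smul_add, smul_inv_smul₀ hτ.ne'] at h1
    convert h1 using 4
    abel
  have h1 := key 0 (by simpa using mul_pos hη hr0)
  have h2 := key (h - r • v) hhv
  rw [sub_zero] at h1
  have h3 : x + h - (h - r • v) = x + r • v := by abel
  rw [h3] at h2
  have h4 := hnet' v hvN
  have h5 : ‖L (r • v - h)‖ ≤ ‖L‖ * (η * r) :=
    (L.le_opNorm _).trans (by rw [norm_sub_rev]; gcongr)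
  have h6 : f (x + h) - f x - L h = (f (x + h) - f q) - (f (x + r • v) - f q) +
      (f (x + r • v) - f x - r • L v) + L (r • v - h) := by
    rw [map_sub, map_smul]; abel
  calc ‖f (x + h) - f x - L h‖
      ≤ K * τ + K * τ + η * r + ‖L‖ * (η * r) := by
        rw [h6]
        refine (norm_add_le _ _).trans (add_le_add ((norm_add_le _ _).trans (add_le_add
          ((norm_sub_le _ _).trans (add_le_add h1 h2)) h4)) h5)
    _ = η * M * r := by simp only [τ, M]; field_simp; ring
    _ ≤ ε * r := by gcongr

end

theorem mainTheorem3 {Y : Type*} [NormedAddCommGroup Y] [NormedSpace ℝ Y] [CompleteSpace Y]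
    (n : ℕ) (G : Set (EuclideanSpace ℝ (Fin n))) (hG : IsOpen G)
    (f : EuclideanSpace ℝ (Fin n) → Y) (hf : ∀ x ∈ G, GateauxDifferentiableAt f x) :
    IsNowhereDense {x ∈ G | ¬ DifferentiableAt ℝ f x} ∧
      IsSigmaPorous {x ∈ G | ¬ DifferentiableAt ℝ f x} := by
  let A : ℕ × ℕ × ℕ → Set (EuclideanSpace ℝ (Fin n)) := fun p =>
    coneLipschitzSet f G (1 / (p.1 + 1)) (p.1 + 1)
      (TopologicalSpace.denseSeq (EuclideanSpace ℝ (Fin n)) p.2.1) (1 / (p.2.2 + 1))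
  have hcov : G ⊆ ⋃ p, A p := fun x hx => by
    obtain ⟨m, i, l, h⟩ := exists_mem_coneLipschitzSet hG hf hx
    exact Set.mem_iUnion.2 ⟨(m, i, l), h⟩
  have hpor : ∀ p, ∀ x ∈ G, ¬ DifferentiableAt ℝ f x → IsPorousAt (A p) x := by
    intro p x hx hnd
    by_contra h
    exact hnd (differentiableAt_of_not_isPorousAt (by positivity) (by positivity) (by positivity)
      h (hf x hx))
  constructor
  · by_contra hne
    obtain ⟨z, hz⟩ := Set.nonempty_iff_ne_empty.2 hne
    obtain ⟨y, hyV, hyG, -⟩ := mem_closure_iff.1 (interior_subset hz) _ isOpen_interior hz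
    obtain ⟨p, w, hwA, hwV, hwG⟩ := IsLineClosed.exists_interior_inter_nonempty (D := A)
      (fun p => isLineClosed_coneLipschitzSet (fun x hx v => (hf x hx).continuousAt_line v)
        (by positivity) _ _ _) (isOpen_interior.inter hG) ⟨y, hyV, hyG⟩
      (Set.inter_subset_right.trans hcov)
    obtain ⟨x, hxA, hxG, hnd⟩ :=
      mem_closure_iff.1 (interior_subset hwV) _ isOpen_interior hwA
    exact not_isPorousAt_of_mem_interior hxA (hpor p x hxG hnd)
  · obtain ⟨g, hg⟩ := exists_surjective_nat (ℕ × ℕ × ℕ)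
    refine ⟨fun k => {x ∈ G | ¬ DifferentiableAt ℝ f x} ∩ A (g k),
      fun k x hx => (hpor (g k) x hx.1.1 hx.1.2).mono Set.inter_subset_right, ?_⟩
    rw [← Set.inter_iUnion, hg.iUnion_comp A]
    exact (Set.inter_eq_left.2 fun x hx => hcov hx.1).symm
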